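/- **Setting.** Let $Q(v_0,\dots,v_{k-1})$, $k\ge 1$, be a full conjunctive query with atoms $R^1,\dots,R^m$ in which every atom has its own relation symbol, the argument list of every atom is a nonempty subsequence of the variable ordering $[v_0,\dots,v_{k-1}]$, and every variable occurs in some atom. An instance $\mathcal A$ assigns to every relation symbol a finite relation over $\mathbb N$ of the right arity; $Q^{\mathcal A}\subseteq\mathbb N^k$ is the set of assignments satisfying all atoms, and $N_{\max}(\mathcal A)$ is the cardinality of the largest relation of $\mathcal A$. A *family of problem instances* is a monotone map $n\mapsto \mathbf K_n$ from a preordered set of parameters (e.g. $\mathbb N$, or $\mathbb N^r$ with the componentwise order) to sets of instances. It is *defined by cardinality constraints on projections* if there is a set of constraints, each consisting of an atom $R^j$, a set $S$ of its argument positions, and a real-valued function $b$ of the parameter, such that $\mathcal A\in\mathbf K_n$ if and only if $|\pi_S(R^{j,\mathcal A})|\le b(n)$ for all these constraints. Put $$q(n)=\max_{\mathcal A\in\mathbf K_n}|Q^{\mathcal A}|,\qquad M(n)=\max_{\mathcal A\in\mathbf K_n}N_{\max}(\mathcal A).$$ *Leapfrog triejoin* computes $Q^{\mathcal A}$ by a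 backtracking search that binds $v_0,v_1,\dots$ in turn. Each relation is presented by a trie iterator with operations key, atEnd, next, seek, open, up. For each variable, a leapfrog join of the iterators of the atoms containing it enumerates the common keys in increasing order, by repeatedly moving the iterator with the smallest key to the least key that is at least the largest current key of the iterators. The operations key and atEnd, the output of a tuple and all bookkeeping steps take time at most $K$; the operations next, seek, open and up on a relation with $N$ tuples take time at most $K(1+\log_2 N)$ (with $\log_2 0$ read as $0$). **Theorem.** Leapfrog triejoin is worst-case optimal, up to a log factor, for families of problem instances defined by cardinality constraints on projections of the input relations. That is: 1. On every instance $\mathcal A$, leapfrog triejoin terminates and outputs every tuple of $Q^{\mathcal A}$ exactly once, and nothing else. 2. There is a constant $C$, depending only on the query and on $K$, such that for every family $(\mathbf K_n)$ defined by cardinality constraints on projections, every parameter $n$ for which $q(n)$ exists and $q(n)\ge 1$, and every $\mathcal A\in\mathbf K_n$, the running time of leapfrog triejoin on $\mathcal A$ is at most $C\,q(n)\,(1+\log_2 N_{\max}(\mathcal A))$; in particular, if $M(n)$ exists, it is at most $C\,q(n)\,(1+\log_2 M(n))$. 3. For every such family and every $n$ for which $q(n)$ exists, any algorithm that outputs exactly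 the tuples of $Q^{\mathcal A}$ for every $\mathcal A\in\mathbf K_n$, and outputs at most one tuple per step, makes at least $q(n)$ steps on some $\mathcal A\in\mathbf K_n$. -/

import Mathlib

/-! ## Queries, instances, families of instances -/

/-- A full conjunctive query `Q(v₀, …, v_{k-1})` in the form used by leapfrog triejoin.
The variables, in the chosen variable ordering, are the elements of `Fin numVars`. Every atom has
its own relation symbol, and its argument list is a nonempty subsequence of the variable ordering
(so no variable is repeated in it and there are no constants). Every variable occurs in an atom. -/
structure JoinQuery where
  numVars : ℕ
  numVars_pos : 0 < numVars
  numAtoms : ℕ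
  arity : Fin numAtoms → ℕ
  arity_pos : ∀ j, 0 < arity j
  args : ∀ j, Fin (arity j) ↪o Fin numVars
  covers : ∀ v, ∃ j, ∃ e, args j e = v

namespace JoinQuery

/-- A problem instance: a finite relation over `ℕ` for every relation symbol of the query. -/
abbrev Instance (Q : JoinQuery) : Type :=
  ∀ j : Fin Q.numAtoms, Finset (Fin (Q.arity j) → ℕ)

/-- An assignment of values to the variables of the query. -/
abbrev Assignment (Q : JoinQuery) : Type := Fin Q.numVars → ℕ

variable {Q : JoinQuery}

/-- The query result: the assignments that satisfy all atoms. -/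
def answers (A : Q.Instance) : Set Q.Assignment :=
  {x | ∀ j, (fun e => x (Q.args j e)) ∈ A j}

/-- The projection of the relation of atom `j` to the argument positions in `cols`. -/
def proj (A : Q.Instance) (j : Fin Q.numAtoms) (cols : Finset (Fin (Q.arity j))) :
    Finset ({e // e ∈ cols} → ℕ) :=
  (A j).image fun t e => t e.1

/-- The cardinality of the largest relation of an instance. -/
def maxCard (A : Q.Instance) : ℕ :=
  Finset.univ.sup fun j => (A j).card

/-- A family of problem instances, indexed by a parameter from a preordered set `P`
(such as `ℕ`, or tuples of natural numbers with the componentwise order). -/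
structure ProblemFamily (Q : JoinQuery) (P : Type*) [Preorder P] where
  inst : P → Set Q.Instance
  mono : Monotone inst

/-- An upper bound, depending on the parameter, on the size of a projection of a relation. -/
structure ProjConstraint (Q : JoinQuery) (P : Type*) where
  atom : Fin Q.numAtoms
  cols : Finset (Fin (Q.arity atom))
  bound : P → ℝ

/-- The family consists of exactly the instances which satisfy the given constraints. -/
def ProblemFamily.IsDefinedBy {P : Type*} [Preorder P] (F : ProblemFamily Q P)
    (cons : Set (ProjConstraint Q P)) : Prop :=
  ∀ n A, A ∈ F.inst n ↔ ∀ c ∈ cons, ((proj A c.atom c.cols).card : ℝ) ≤ c.bound n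

/-! ## Trie iterators -/

/-- The keys of the children of the trie node with the given path from the root,
in increasing order. (Only used for paths shorter than the arity `a`.) -/
def trieChildren {a : ℕ} (R : Finset (Fin a → ℕ)) (path : List ℕ) : List ℕ :=
  ((R.filter fun t => (List.ofFn t).take path.length = path).image
    fun t => (List.ofFn t).getD path.length 0).sort (· ≤ ·)

/-- The state of a trie iterator: for each trie level that has been opened, deepest level first,
the sibling keys from the current position on. The first entry of each list is the key at which
the iterator is positioned on that level; an empty list means that it is at the end there.
The state `[]` is the root. -/
abbrev TrieIter : Type := List (List ℕ)

namespace TrieIter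

def key (it : TrieIter) : ℕ := (it.headD []).headD 0

def atEnd (it : TrieIter) : Bool := (it.headD []).isEmpty

def next : TrieIter → TrieIter
  | [] => []
  | l :: ls => l.tail :: ls

/-- Move to the least key `≥ x` on the current level, or to the end if there is none. -/
def seek (x : ℕ) : TrieIter → TrieIter
  | [] => []
  | l :: ls => l.dropWhile (fun y => decide (y < x)) :: ls

/-- Proceed to the first key on the next level. -/
def descend {a : ℕ} (R : Finset (Fin a → ℕ)) (it : TrieIter) : TrieIter :=
  trieChildren R (it.map fun l => l.headD 0).reverse :: it

/-- Return to the parent key. -/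
def up (it : TrieIter) : TrieIter := it.tail

end TrieIter

/-- The operations of the trie iterator interface (`descend` is the operation `open()`). -/
inductive IterOp where
  | key
  | atEnd
  | next
  | seek (x : ℕ)
  | descend
  | up

/-- The elementary events of an execution: an operation of the trie iterator of an atom, a
bookkeeping step of the RAM, or the output of a result tuple. -/
inductive Event (Q : JoinQuery) where
  | iter (j : Fin Q.numAtoms) (op : IterOp)
  | ram
  | emit (x : Q.Assignment)

/-! ## Leapfrog triejoin -/

/-- The leapfrog join of one variable: the array of (pointers to) the trie iterators of the atoms
which contain the variable, read cyclically from the position `p` on, so that the first entry is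
`Iter[p]` and the last one is `Iter[p - 1]`; and the last key found. -/
structure Frame (Q : JoinQuery) where
  queue : List (Fin Q.numAtoms)
  key : ℕ

/-- The program point. `enter`: call triejoin-open() for the next variable. `search x'`: the head
of the loop of leapfrog-search(), where `x'` is the largest key of any iterator. `result`: the
current leapfrog join is positioned at a key. `advance`: call leapfrog-next(). `leave`: the current
leapfrog join is at its end, call triejoin-up(). -/
inductive Phase where
  | enter
  | search (x' : ℕ)
  | result
  | advance
  | leave
  | done

/-- A state of the execution. `frames` are the leapfrog joins of the variables that have been
opened, deepest first; `trace` records the events so far. -/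
structure Config (Q : JoinQuery) where
  iters : Fin Q.numAtoms → TrieIter
  frames : List (Frame Q)
  phase : Phase
  trace : List (Event Q)

/-- The atoms which contain the variable number `d`. -/
def atomsAt (Q : JoinQuery) (d : ℕ) : List (Fin Q.numAtoms) :=
  (List.finRange Q.numAtoms).filter fun j => decide (∃ e, (Q.args j e : ℕ) = d)

/-- The assignment read off from the keys of the leapfrog joins. -/
def currentAssignment (frames : List (Frame Q)) : Q.Assignment :=
  fun v => (frames.map Frame.key).reverse.getD v 0

/-- The initial state: all trie iterators are at the root, no variable has been opened. -/
def initConfig (Q : JoinQuery) : Config Q where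
  iters := fun _ => []
  frames := []
  phase := .enter
  trace := []

/-- triejoin-open(), including leapfrog-init(), which tests whether an iterator is at the end, and
otherwise sorts the `k` iterators by their keys (with at most `k ^ 2` comparisons) and starts
leapfrog-search() by reading the largest key. -/
def stepEnter (A : Q.Instance) (c : Config Q) : Config Q :=
  let js := atomsAt Q c.frames.length
  let iters : Fin Q.numAtoms → TrieIter :=
    fun j => if j ∈ js then (c.iters j).descend (A j) else c.iters j
  let ev := js.map (fun j => Event.iter j .descend) ++ js.map (fun j => Event.iter j .atEnd)
  if js.any (fun j => (iters j).atEnd) then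
    { iters := iters
      frames := ⟨js, 0⟩ :: c.frames
      phase := .leave
      trace := c.trace ++ ev }
  else
    let queue := js.insertionSort (fun i j => (iters i).key ≤ (iters j).key)
    { iters := iters
      frames := ⟨queue, 0⟩ :: c.frames
      phase := .search ((queue.getLast?.map fun j => (iters j).key).getD 0)
      trace := c.trace ++ ev ++ js.map (fun j => Event.iter j .key)
        ++ List.replicate (js.length ^ 2) .ram
        ++ queue.getLast?.toList.map (fun j => Event.iter j .key) }

/-- One iteration of the loop of leapfrog-search(). -/
def stepSearch (x' : ℕ) (c : Config Q) : Config Q :=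
  match c.frames with
  | ⟨j :: rest, key⟩ :: fs =>
    let x := (c.iters j).key
    if x = x' then
      { c with
        frames := ⟨j :: rest, x⟩ :: fs
        phase := .result
        trace := c.trace ++ [.iter j .key, .ram] }
    else
      let it := (c.iters j).seek x'
      let ev := [.iter j .key, .ram, .iter j (.seek x'), .iter j .atEnd]
      if it.atEnd then
        { iters := Function.update c.iters j it
          frames := c.frames
          phase := .leave
          trace := c.trace ++ ev }
      else
        { iters := Function.update c.iters j it
          frames := ⟨rest ++ [j], key⟩ :: fs
          phase := .search it.key
          trace := c.trace ++ ev ++ [.iter j .key, .ram] }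
  | _ => c

/-- A key has been found: output the assignment if all variables are bound, and go on with the next
key; otherwise turn to the next variable. -/
def stepResult (c : Config Q) : Config Q :=
  if c.frames.length = Q.numVars then
    { c with
      phase := .advance
      trace := c.trace ++ [.ram, .emit (currentAssignment c.frames)] }
  else
    { c with
      phase := .enter
      trace := c.trace ++ [.ram] }

/-- leapfrog-next(), up to the loop of leapfrog-search(). -/
def stepAdvance (c : Config Q) : Config Q :=
  match c.frames with
  | ⟨j :: rest, key⟩ :: fs =>
    let it := (c.iters j).next
    let ev := [.iter j .next, .iter j .atEnd]
    if it.atEnd then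
      { iters := Function.update c.iters j it
        frames := c.frames
        phase := .leave
        trace := c.trace ++ ev }
    else
      { iters := Function.update c.iters j it
        frames := ⟨rest ++ [j], key⟩ :: fs
        phase := .search it.key
        trace := c.trace ++ ev ++ [.ram, .iter j .key] }
  | _ => c

/-- triejoin-up(), after which the traversal goes on with the next key of the previous variable,
if there is one. -/
def stepLeave (c : Config Q) : Config Q :=
  match c.frames with
  | f :: fs =>
    { iters := fun j => if j ∈ f.queue then (c.iters j).up else c.iters j
      frames := fs
      phase := if fs.isEmpty then .done else .advance
      trace := c.trace ++ f.queue.map (fun j => Event.iter j .up) ++ [.ram] }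
  | [] => c

/-- One step of the complete traversal of the trie presented by leapfrog triejoin. -/
def step (A : Q.Instance) (c : Config Q) : Config Q :=
  match c.phase with
  | .enter => stepEnter A c
  | .search x' => stepSearch x' c
  | .result => stepResult c
  | .advance => stepAdvance c
  | .leave => stepLeave c
  | .done => c

/-- Leapfrog triejoin terminates on the instance `A`, and `tr` is the list of the events of
its execution. -/
def LeapfrogTriejoin (A : Q.Instance) (tr : List (Event Q)) : Prop :=
  ∃ t : ℕ, ((step A)^[t] (initConfig Q)).phase = .done ∧ ((step A)^[t] (initConfig Q)).trace = tr

/-- The tuples output in an execution, in the order of their output. -/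
def output (tr : List (Event Q)) : List Q.Assignment :=
  tr.filterMap fun
    | .emit x => some x
    | _ => none

/-! ## Running time -/

/-- The times taken by the events: `T A h e` is the time of the event `e` on the instance `A` after
the events `h` (it may depend on the past, as an implementation of iterators has an
internal state). -/
abbrev CostModel (Q : JoinQuery) : Type :=
  Q.Instance → List (Event Q) → Event Q → ℕ

/-- The requirements on the iterators, with constant `K`: `key()` and `atEnd()` take time `O(1)`,
and `next()`, `seek()`, `open()`, `up()` take time `O(log N)`, where `N` is the cardinality of the
relation (read as `O(1 + log N)`, as `N = 1` is possible). Other steps take time `O(1)`. -/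
def CostModel.Meets (T : CostModel Q) (K : ℕ) : Prop :=
  ∀ A h,
    T A h .ram ≤ K ∧ (∀ x, T A h (.emit x) ≤ K) ∧
    ∀ j, T A h (.iter j .key) ≤ K ∧ T A h (.iter j .atEnd) ≤ K ∧
      ∀ op, (T A h (.iter j op) : ℝ) ≤ K * (1 + Real.logb 2 (A j).card)

/-- The time of an execution with the events `tr`. -/
def CostModel.time (T : CostModel Q) (A : Q.Instance) (tr : List (Event Q)) : ℕ :=
  ∑ i : Fin tr.length, T A (tr.take i) (tr.get i)

/-- An arbitrary deterministic join algorithm, of which only this is recorded: on every instance it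
makes a finite sequence of steps, and each step outputs at most one tuple. -/
abbrev Algorithm (Q : JoinQuery) : Type := Q.Instance → List (Option Q.Assignment)

/-- The algorithm outputs exactly the tuples of the query result on the instances in `S`. -/
def Algorithm.Computes (B : Algorithm Q) (S : Set Q.Instance) : Prop :=
  ∀ A ∈ S, ∀ x, some x ∈ B A ↔ x ∈ answers A

end JoinQuery

namespace JoinQuery

variable {Q : JoinQuery}

/-! The run is a depth-first traversal of a tree whose nodes are the partial bindings `p` that
satisfy the joins made so far. The join at `p` moves its iterators in cyclic order, so the one with
the fewest keys is moved at least once per round; the join ends after at most `minChildren A p`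
rounds (`exists_rotate_eq`, `reaches_leave`). Hence the number of events is at most a constant times
the sum of `1 + minChildren A p` over all nodes, which `work` records.

It remains to bound, for each depth `d`, the sum of `minChildren A p` over the nodes of depth `d` by
`q`. It may exceed the number of answers on `A`, because the keys offered by different atoms need
not coincide. `renumber A d` makes them coincide: the value of variable `d` is replaced by its rank
among its siblings, and later variables become `0`. At each node the ranks below `minChildren A p`
are then offered by all its atoms, so every pair of a node and such a rank gives its own answer of
the new instance (`sum_minChildren_le`).

Renumbering enlarges no projection, except that an empty relation becomes a singleton
(`card_proj_renumber_le`). As `q ≥ 1`, all bounds of the family are at least `1`, so the new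
instance stays in the family (`renumber_mem_inst`) and has at most `q` answers. Summation over the
depths gives `length_le_of_family`, and each event costs at most `K * (1 + log N)`. Correctness of
the output is `mem_results`; the lower bound is a count of outputs on an instance with `q` answers.
-/

/-! ## The search tree -/

/-- The path in the trie of the atom `j` which belongs to the bindings `p` of the first variables.
Both are given with the deepest key first. -/
def revPath (j : Fin Q.numAtoms) : List ℕ → List ℕ
  | [] => []
  | y :: p => if j ∈ atomsAt Q p.length then y :: revPath j p else revPath j p

/-- The keys which the atom `j` offers for the next variable. -/
def children (A : Q.Instance) (j : Fin Q.numAtoms) (p : List ℕ) : List ℕ :=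
  trieChildren (A j) (revPath j p).reverse

/-- The keys for the next variable on which all its atoms agree. -/
def commonKeys (A : Q.Instance) (p : List ℕ) : Finset ℕ :=
  (Finset.univ.biUnion fun j => (children A j p).toFinset).filter
    fun y => ∀ j ∈ atomsAt Q p.length, y ∈ children A j p

/-- The least number of keys that an atom offers for the next variable. -/
noncomputable def minChildren (A : Q.Instance) (p : List ℕ) : ℕ :=
  sInf {n | ∃ j ∈ atomsAt Q p.length, (children A j p).length = n}

/-- The assignment with the given bindings of the first variables, and zeros elsewhere. -/
def assignmentOf (Q : JoinQuery) (p : List ℕ) : Q.Assignment := fun v => p.reverse.getD v 0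

/-- The output below a node of the search tree, with `m` variables left to bind. -/
def results (A : Q.Instance) : ℕ → List ℕ → List Q.Assignment
  | 0, p => [assignmentOf Q p]
  | m + 1, p => ((commonKeys A p).sort (· ≤ ·)).flatMap fun y => results A m (y :: p)

/-- A bound for the number of events per node and child of the search tree. -/
def nodeCost (Q : JoinQuery) : ℕ := Q.numAtoms ^ 2 + 10 * Q.numAtoms + 3

/-- A bound for the number of events below a node, with `m` variables left to bind. -/
noncomputable def work (A : Q.Instance) : ℕ → List ℕ → ℕ
  | 0, _ => nodeCost Q
  | m + 1, p => nodeCost Q * (1 + minChildren A p) + ∑ y ∈ commonKeys A p, work A m (y :: p)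

lemma nodup_atomsAt (d : ℕ) : (atomsAt Q d).Nodup := (List.nodup_finRange _).filter _

lemma length_atomsAt_le (d : ℕ) : (atomsAt Q d).length ≤ Q.numAtoms :=
  (List.length_filter_le _ _).trans (List.length_finRange).le

lemma mem_atomsAt {d : ℕ} {j : Fin Q.numAtoms} :
    j ∈ atomsAt Q d ↔ ∃ e, (Q.args j e : ℕ) = d := by
  simp [atomsAt]

lemma exists_mem_atomsAt {d : ℕ} (hd : d < Q.numVars) : ∃ j, j ∈ atomsAt Q d := by
  obtain ⟨j, e, h⟩ := Q.covers ⟨d, hd⟩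
  exact ⟨j, mem_atomsAt.2 ⟨e, by rw [h]⟩⟩

lemma sorted_children (A : Q.Instance) (j : Fin Q.numAtoms) (p : List ℕ) :
    (children A j p).Pairwise (· < ·) := by
  rw [children, trieChildren]
  exact Finset.sortedLT_sort _ |>.pairwise

/-- The union over all atoms in `commonKeys` only serves to make the set finite: as every variable
occurs in an atom, it excludes nothing. -/
lemma mem_commonKeys {A : Q.Instance} {p : List ℕ} (hp : p.length < Q.numVars) {y : ℕ} :
    y ∈ commonKeys A p ↔ ∀ j ∈ atomsAt Q p.length, y ∈ children A j p := by
  obtain ⟨j, hj⟩ := exists_mem_atomsAt hp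
  simp only [commonKeys, Finset.mem_filter, Finset.mem_biUnion, Finset.mem_univ, true_and,
    List.mem_toFinset, and_iff_right_iff_imp]
  exact fun h => ⟨j, h j hj⟩

lemma exists_length_eq_minChildren (A : Q.Instance) {p : List ℕ} (hp : p.length < Q.numVars) :
    ∃ j ∈ atomsAt Q p.length, (children A j p).length = minChildren A p := by
  obtain ⟨j, hj⟩ := exists_mem_atomsAt hp
  exact Nat.sInf_mem (s := {n | ∃ j ∈ atomsAt Q p.length, (children A j p).length = n})
    ⟨_, j, hj, rfl⟩

lemma minChildren_le (A : Q.Instance) {p : List ℕ} {j : Fin Q.numAtoms}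
    (hj : j ∈ atomsAt Q p.length) : minChildren A p ≤ (children A j p).length :=
  Nat.sInf_le ⟨j, hj, rfl⟩

/-! ## The leapfrog join of one variable -/

/-- Execution of some number of steps. -/
def Reaches (A : Q.Instance) : Config Q → Config Q → Prop :=
  Relation.ReflTransGen fun c c' => step A c = c'

lemma Reaches.exists_iterate {A : Q.Instance} {c c' : Config Q} (h : Reaches A c c') :
    ∃ t, (step A)^[t] c = c' := by
  induction h with
  | refl => exact ⟨0, rfl⟩
  | tail _ h ih =>
    obtain ⟨t, rfl⟩ := ih
    exact ⟨t + 1, by rw [Function.iterate_succ_apply', h]⟩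

lemma Reaches.step (A : Q.Instance) (c : Config Q) : Reaches A c (step A c) :=
  Relation.ReflTransGen.single rfl

lemma Reaches.trans {A : Q.Instance} {a b c : Config Q} (h : Reaches A a b) (h' : Reaches A b c) :
    Reaches A a c :=
  Relation.ReflTransGen.trans h h'

/-- The iterators of the atoms in `js` have one more level open than `base`. -/
def openIters (js : List (Fin Q.numAtoms)) (base : Fin Q.numAtoms → TrieIter)
    (l : Fin Q.numAtoms → List ℕ) : Fin Q.numAtoms → TrieIter :=
  fun j => if j ∈ js then l j :: base j else base j

lemma openIters_of_mem {js : List (Fin Q.numAtoms)} {base : Fin Q.numAtoms → TrieIter}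
    {l : Fin Q.numAtoms → List ℕ} {j : Fin Q.numAtoms} (hj : j ∈ js) :
    openIters js base l j = l j :: base j := if_pos hj

lemma update_openIters {js : List (Fin Q.numAtoms)} {base : Fin Q.numAtoms → TrieIter}
    {l : Fin Q.numAtoms → List ℕ} {j : Fin Q.numAtoms} (hj : j ∈ js) (s : List ℕ) :
    Function.update (openIters js base l) j (s :: base j) =
      openIters js base (Function.update l j s) := by
  funext i
  by_cases h : i = j
  · subst h; simp [openIters, hj]
  · simp [openIters, h]

/-- The invariant of leapfrog-search(): the queue is ordered by keys and `x'` is the largest key.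
`ys` are the common keys that have not been passed yet. -/
structure JoinInv (js : List (Fin Q.numAtoms)) (l : Fin Q.numAtoms → List ℕ)
    (queue : List (Fin Q.numAtoms)) (x' : ℕ) (ys : List ℕ) : Prop where
  perm : queue.Perm js
  sorted : ∀ j ∈ js, (l j).Pairwise (· < ·)
  ne_nil : ∀ j ∈ js, l j ≠ []
  mono : queue.Pairwise fun i j => (l i).headD 0 ≤ (l j).headD 0
  le : ∀ j ∈ js, (l j).headD 0 ≤ x'
  attained : ∃ j ∈ js, (l j).headD 0 = x'
  sorted_keys : ys.Pairwise (· < ·)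
  mem_keys : ∀ y, y ∈ ys ↔ ∀ j ∈ js, y ∈ l j

lemma headD_le_of_mem {l : List ℕ} (h : l.Pairwise (· < ·)) {y : ℕ} (hy : y ∈ l) :
    l.headD 0 ≤ y := by
  cases l with
  | nil => simp at hy
  | cons a l =>
    rcases List.mem_cons.1 hy with rfl | hy
    · exact le_rfl
    · exact (List.rel_of_pairwise_cons h hy).le

lemma headD_mem {l : List ℕ} (h : l ≠ []) : l.headD 0 ∈ l := by
  cases l with
  | nil => exact absurd rfl h
  | cons a l => simp

/-- The moved iterator now has a key that is at least the old maximum, so it belongs at the end of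
the queue and its key is the new maximum. -/
lemma JoinInv.rotate {js : List (Fin Q.numAtoms)} (hjs : js.Nodup)
    {l : Fin Q.numAtoms → List ℕ} {j : Fin Q.numAtoms} {rest : List (Fin Q.numAtoms)} {x' : ℕ}
    {ys ys' : List ℕ} (h : JoinInv js l (j :: rest) x' ys) {s : List ℕ} (hs : s ≠ [])
    (hsl : s.Sublist (l j)) (hle : x' ≤ s.headD 0) (hys : ys'.Sublist ys)
    (hmem : ∀ y, y ∈ ys' ↔ ∀ i ∈ js, y ∈ Function.update l j s i) :
    JoinInv js (Function.update l j s) (rest ++ [j]) (s.headD 0) ys' := by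
  have hnd : (j :: rest).Nodup := h.perm.nodup_iff.2 hjs
  have hj : j ∈ js := h.perm.subset (by simp)
  have hrest : ∀ i ∈ rest, i ≠ j := fun i hi e => (List.nodup_cons.1 hnd).1 (e ▸ hi)
  have hrjs : ∀ i ∈ rest, i ∈ js := fun i hi => h.perm.subset (by simp [hi])
  refine ⟨(List.perm_append_singleton j rest).trans h.perm, fun i hi => ?_, fun i hi => ?_, ?_,
    fun i hi => ?_, ⟨j, hj, by simp⟩, h.sorted_keys.sublist hys, hmem⟩
  · by_cases e : i = j
    · subst e; simpa using (h.sorted i hi).sublist hsl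
    · simpa [e] using h.sorted i hi
  · by_cases e : i = j
    · subst e; simpa using hs
    · simpa [e] using h.ne_nil i hi
  · refine List.pairwise_append.2 ⟨?_, by simp, ?_⟩
    · refine ((List.pairwise_cons.1 h.mono).2).imp_of_mem fun {a b} ha hb hab => ?_
      simpa [hrest a ha, hrest b hb] using hab
    · intro i hi b hb
      obtain rfl : b = j := by simpa using hb
      simpa [hrest i hi] using (h.le i (hrjs i hi)).trans hle
  · by_cases e : i = j
    · subst e; simp
    · simpa [e] using (h.le i hi).trans hle

/-- The potential is the number of atoms times the number of keys left to `j₀`, plus the position of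
`j₀` in the queue. A move of another iterator brings `j₀` one place forward. A move of `j₀` costs it
a key, which outweighs its return to the end of the queue. -/
lemma exists_rotate_eq {js : List (Fin Q.numAtoms)} {l : Fin Q.numAtoms → List ℕ}
    {j j₀ : Fin Q.numAtoms} {rest pre post : List (Fin Q.numAtoms)} (hjs : js.Nodup)
    (hq : (j :: rest).Perm js) (h : j :: rest = pre ++ j₀ :: post) {s : List ℕ}
    (hs : s.length < (l j).length) :
    ∃ pre' post', rest ++ [j] = pre' ++ j₀ :: post' ∧
      js.length * (Function.update l j s j₀).length + pre'.length + 1 ≤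
        js.length * (l j₀).length + pre.length := by
  cases pre with
  | nil =>
    obtain ⟨rfl, rfl⟩ : j = j₀ ∧ rest = post := by simpa using h
    refine ⟨rest, [], rfl, ?_⟩
    have h1 : js.length = rest.length + 1 := by rw [← hq.length_eq]; rfl
    have h2 : js.length * (s.length + 1) ≤ js.length * (l j).length := Nat.mul_le_mul le_rfl hs
    simp only [Function.update_self, List.length_nil]
    rw [mul_add] at h2
    omega
  | cons a pre =>
    obtain ⟨rfl, rfl⟩ : j = a ∧ rest = pre ++ j₀ :: post := by simpa using h
    have hne : j₀ ≠ j := by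
      have := hq.nodup_iff.2 hjs
      rintro rfl
      simp at this
    exact ⟨pre, post ++ [j], by simp, by simp [hne]⟩

lemma length_dropWhile_lt {l : List ℕ} {x' : ℕ} (hl : l ≠ []) (h : l.headD 0 < x') :
    (l.dropWhile fun y => decide (y < x')).length < l.length := by
  cases l with
  | nil => exact absurd rfl hl
  | cons a l =>
    have : a < x' := h
    simp only [List.dropWhile_cons, this, decide_true, if_true, List.length_cons]
    exact Nat.lt_succ_of_le (List.dropWhile_suffix _).length_le

lemma le_headD_dropWhile {l : List ℕ} {x' : ℕ}
    (h : (l.dropWhile fun y => decide (y < x')) ≠ []) :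
    x' ≤ (l.dropWhile fun y => decide (y < x')).headD 0 := by
  have := List.head_dropWhile_not (fun y => decide (y < x')) (l := l) (h)
  rw [List.headD_eq_head?_getD, List.head?_eq_some_head h]
  simpa using this

lemma mem_dropWhile_of_le {l : List ℕ} {x' y : ℕ} (hy : y ∈ l) (h : x' ≤ y) :
    y ∈ l.dropWhile fun y => decide (y < x') := by
  induction l with
  | nil => simp at hy
  | cons a l ih =>
    rw [List.dropWhile_cons]
    split_ifs with ha
    · rcases List.mem_cons.1 hy with rfl | hy
      · simp at ha; omega
      · exact ih hy
    · exact hy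

/-! ### Output of concatenated traces, and the loop of one leapfrog join -/

lemma output_append (a b : List (Event Q)) : output (a ++ b) = output a ++ output b := by
  simp [output]

@[simp] lemma output_nil : output ([] : List (Event Q)) = [] := rfl

@[simp] lemma output_iter_cons (j : Fin Q.numAtoms) (op : IterOp) (a : List (Event Q)) :
    output (.iter j op :: a) = output a := rfl

@[simp] lemma output_ram_cons (a : List (Event Q)) : output (.ram :: a) = output a := rfl

@[simp] lemma output_emit_cons (x : Q.Assignment) (a : List (Event Q)) :
    output (.emit x :: a) = x :: output a := rfl

/-- The leapfrog join, given the executions `hres` of the rest of the search for each common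
key. -/
theorem reaches_leave (A : Q.Instance) {js : List (Fin Q.numAtoms)} (hjs : js.Nodup)
    (base : Fin Q.numAtoms → TrieIter) (fs : List (Frame Q)) (sub : ℕ → List Q.Assignment)
    (w : ℕ → ℕ) (j₀ : Fin Q.numAtoms)
    (hres : ∀ queue l x tr₀, (∀ j ∈ js, (l j).headD 0 = x) →
      ∃ tr, Reaches A ⟨openIters js base l, ⟨queue, x⟩ :: fs, .result, tr₀⟩
          ⟨openIters js base l, ⟨queue, x⟩ :: fs, .advance, tr₀ ++ tr⟩ ∧
        output tr = sub x ∧ tr.length ≤ w x) (n : ℕ) :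
    ∀ (queue : List (Fin Q.numAtoms)) (l : Fin Q.numAtoms → List ℕ) (key x' : ℕ) (ys : List ℕ)
      (tr₀ : List (Event Q)) (pre post : List (Fin Q.numAtoms)), JoinInv js l queue x' ys →
      queue = pre ++ j₀ :: post →
      -- `n` bounds the remaining iterations. Since `j₀` has a key left, the left side exceeds
      -- `js.length`, so `n = 0` is impossible.
      js.length * (l j₀).length + pre.length + 1 ≤ n + js.length →
      ∃ tr queue' l' key',
        Reaches A ⟨openIters js base l, ⟨queue, key⟩ :: fs, .search x', tr₀⟩
          ⟨openIters js base l', ⟨queue', key'⟩ :: fs, .leave, tr₀ ++ tr⟩ ∧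
        -- An iteration has at most six events of its own, whether it finds a key and advances or
        -- seeks.
        queue'.Perm js ∧ output tr = ys.flatMap sub ∧ tr.length ≤ 6 * n + (ys.map w).sum := by
  induction n with
  | zero =>
    intro queue l key x' ys tr₀ pre post h hq hn
    have hj₀ : j₀ ∈ js := h.perm.subset (by simp [hq])
    have := List.length_pos_iff.2 (h.ne_nil j₀ hj₀)
    have := Nat.mul_le_mul (le_refl js.length) this
    omega
  | succ n ih =>
    intro queue l key x' ys tr₀ pre post h hq hn
    obtain ⟨j, rest, rfl⟩ : ∃ j rest, queue = j :: rest := by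
      cases queue with
      | nil => simp at hq
      | cons j rest => exact ⟨j, rest, rfl⟩
    have hj : j ∈ js := h.perm.subset (by simp)
    have hjl := h.ne_nil j hj
    by_cases hx : (l j).headD 0 = x'
    · -- all iterators are at the same key
      have hall : ∀ i ∈ js, (l i).headD 0 = x' := by
        intro i hi
        refine le_antisymm (h.le i hi) (hx ▸ ?_)
        -- The head of the queue has the least key, and here that equals the largest one.
        rcases List.mem_cons.1 (h.perm.symm.subset hi) with rfl | hi
        · exact le_rfl
        · exact (List.pairwise_cons.1 h.mono).1 i hi
      -- Every iterator is positioned at `x'`, so `x'` is a common key, and no later common key can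
      -- precede it.
      obtain ⟨ys, rfl⟩ : ∃ ys', ys = x' :: ys' := by
        have hmem : x' ∈ ys := (h.mem_keys x').2 fun i hi => by
          rw [← hall i hi]; exact headD_mem (h.ne_nil i hi)
        cases ys with
        | nil => simp at hmem
        | cons z ys =>
          have h1 : x' ≤ z := hx ▸ headD_le_of_mem (h.sorted j hj)
            ((h.mem_keys z).1 (by simp) j hj)
          have h2 := headD_le_of_mem h.sorted_keys hmem
          exact ⟨ys, by rw [le_antisymm h1 h2]⟩
      have s1 := Reaches.step A ⟨openIters js base l, ⟨j :: rest, key⟩ :: fs, .search x', tr₀⟩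
      simp only [step, stepSearch, openIters_of_mem hj, TrieIter.key, List.headD_cons, hx,
        if_true] at s1
      obtain ⟨tr₁, s2, ho₁, hl₁⟩ := hres (j :: rest) l x' (tr₀ ++ [.iter j .key, .ram]) hall
      have s3 := Reaches.step A ⟨openIters js base l, ⟨j :: rest, x'⟩ :: fs, .advance,
        tr₀ ++ [.iter j .key, .ram] ++ tr₁⟩
      simp only [step, stepAdvance, openIters_of_mem hj, TrieIter.key, List.headD_cons,
        TrieIter.next, TrieIter.atEnd, update_openIters hj] at s3
      obtain ⟨r, hr⟩ : ∃ r, l j = x' :: r := by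
        cases hl : l j with
        | nil => exact absurd hl hjl
        | cons a r => rw [hl] at hx; exact ⟨r, by rw [← hx]; rfl⟩
      have hrs := h.sorted j hj
      rw [hr, List.pairwise_cons] at hrs
      have hysr := List.pairwise_cons.1 h.sorted_keys
      -- Only iterator `j` leaves `x'`. That removes `x'`, and nothing else, from the common keys.
      have hmem : ∀ y, y ∈ ys ↔ ∀ i ∈ js, y ∈ Function.update l j r i := by
        intro y
        constructor
        · intro hy i hi
          have hyi := (h.mem_keys y).1 (by simp [hy]) i hi
          by_cases e : i = j
          · subst e
            rw [hr] at hyi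
            rcases List.mem_cons.1 hyi with rfl | hyi
            · exact absurd (hysr.1 _ hy) (lt_irrefl _)
            · simpa using hyi
          · simpa [e] using hyi
        · intro hy
          have hyr : y ∈ r := by simpa using hy j hj
          have : y ∈ x' :: ys := (h.mem_keys y).2 fun i hi => by
            by_cases e : i = j
            · subst e; simp [hr, hyr]
            · simpa [e] using hy i hi
          rcases List.mem_cons.1 this with rfl | hy'
          · exact absurd (hrs.1 _ hyr) (lt_irrefl _)
          · exact hy'
      simp only [hr, List.tail_cons] at s3
      by_cases hre : r = []
      · have hys : ys = [] := by
          rcases ys with _ | ⟨y, ys⟩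
          · rfl
          · have := (hmem y).1 (by simp) j hj
            simp [hre] at this
        simp only [hre, List.isEmpty_nil, if_true] at s3
        refine ⟨[.iter j .key, .ram] ++ tr₁ ++ [.iter j .next, .iter j .atEnd], _, _, _,
          by simpa only [List.append_assoc] using (s1.trans s2).trans s3, h.perm, ?_, ?_⟩
        · simp [output_append, ho₁, hys]
        · simp [hys]; omega
      · simp only [List.isEmpty_iff, hre, if_false] at s3
        have hlt : r.length < (l j).length := by simp [hr]
        obtain ⟨pre', post', hq', hn'⟩ := exists_rotate_eq hjs h.perm hq hlt
        have hle : x' ≤ r.headD 0 := (hrs.1 _ (headD_mem hre)).le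
        obtain ⟨tr₂, queue', l', key', s4, hp, ho₂, hl₂⟩ := ih (rest ++ [j])
          (Function.update l j r) x' (r.headD 0) ys
          (tr₀ ++ [.iter j .key, .ram] ++ tr₁ ++ [.iter j .next, .iter j .atEnd] ++
            [.ram, .iter j .key]) pre' post'
          (h.rotate hjs hre (by simp [hr]) hle (by simp) hmem) hq' (by omega)
        refine ⟨[.iter j .key, .ram] ++ tr₁ ++ [.iter j .next, .iter j .atEnd] ++
          [.ram, .iter j .key] ++ tr₂, queue', l', key', by
            simpa only [List.append_assoc] using ((s1.trans s2).trans s3).trans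
              (by simpa only [List.append_assoc] using s4), hp, ?_, ?_⟩
        · simp [output_append, ho₁, ho₂]
        · simp; omega
    · have s1 := Reaches.step A ⟨openIters js base l, ⟨j :: rest, key⟩ :: fs, .search x', tr₀⟩
      simp only [step, stepSearch, openIters_of_mem hj, TrieIter.key, List.headD_cons, hx,
        if_false, TrieIter.seek, TrieIter.atEnd, update_openIters hj] at s1
      have hlt := length_dropWhile_lt hjl (lt_of_le_of_ne (h.le j hj) hx)
      set s := (l j).dropWhile fun y => decide (y < x') with hs
      have hsub : s.Sublist (l j) := List.dropWhile_sublist _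
      -- `x'` is the least remaining key of some atom, so the skipped keys below `x'` are not common
      -- keys.
      have hmem : ∀ y, y ∈ ys ↔ ∀ i ∈ js, y ∈ Function.update l j s i := by
        intro y
        rw [h.mem_keys]
        constructor
        · intro hy i hi
          by_cases e : i = j
          · subst e
            obtain ⟨i', hi', hx'⟩ := h.attained
            rw [Function.update_self]
            exact mem_dropWhile_of_le (hy i hi)
              (hx' ▸ headD_le_of_mem (h.sorted i' hi') (hy i' hi'))
          · simpa [e] using hy i hi
        · intro hy i hi
          by_cases e : i = j
          · subst e; exact hsub.subset (by simpa using hy i hi)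
          · simpa [e] using hy i hi
      by_cases hse : s = []
      · have hys : ys = [] := by
          rcases ys with _ | ⟨y, ys⟩
          · rfl
          · have := (hmem y).1 (by simp) j hj
            simp [hse] at this
        simp only [hse, List.isEmpty_nil, if_true] at s1
        refine ⟨_, _, _, _, s1, h.perm, ?_, ?_⟩
        · simp [hys]
        · simp [hys]; omega
      · simp only [List.isEmpty_iff, hse, if_false] at s1
        obtain ⟨pre', post', hq', hn'⟩ := exists_rotate_eq hjs h.perm hq hlt
        obtain ⟨tr₂, queue', l', key', s4, hp, ho₂, hl₂⟩ := ih (rest ++ [j])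
          (Function.update l j s) key (s.headD 0) ys
          (tr₀ ++ [.iter j .key, .ram, .iter j (.seek x'), .iter j .atEnd] ++
            [.iter j .key, .ram]) pre' post'
          (h.rotate hjs hse hsub (le_headD_dropWhile hse) (by simp) hmem) hq' (by omega)
        refine ⟨[.iter j .key, .ram, .iter j (.seek x'), .iter j .atEnd] ++
          [.iter j .key, .ram] ++ tr₂, queue', l', key', by
            simpa only [List.append_assoc] using s1.trans
              (by simpa only [List.append_assoc] using s4), hp, ?_, ?_⟩
        · rw [output_append, ho₂]; rfl
        · simp; omega

/-! ## The traversal of the search tree -/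

lemma sum_map_sort (s : Finset ℕ) (w : ℕ → ℕ) : ((s.sort (· ≤ ·)).map w).sum = ∑ y ∈ s, w y := by
  rw [Finset.sum, ← Finset.sort_eq s (· ≤ ·), Multiset.map_coe, Multiset.sum_coe]

lemma descend_iters (A : Q.Instance) {iters : Fin Q.numAtoms → TrieIter} {p : List ℕ}
    (h : ∀ j, (iters j).map (fun l => l.headD 0) = revPath j p) (js : List (Fin Q.numAtoms))
    (j : Fin Q.numAtoms) : (if j ∈ js then (iters j).descend (A j) else iters j) =
      openIters js iters (fun j => children A j p) j := by
  simp only [openIters, TrieIter.descend, children, h]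

/-- Preservation of the invariant that ties the iterators to the search tree when a variable is
bound to `x`. -/
lemma map_headD_openIters {fs : List (Frame Q)} {iters : Fin Q.numAtoms → TrieIter} {d : ℕ}
    (hd : fs.length = d)
    (h : ∀ j, (iters j).map (fun l => l.headD 0) = revPath j (fs.map Frame.key))
    {l : Fin Q.numAtoms → List ℕ} {x : ℕ} (hx : ∀ j ∈ atomsAt Q d, (l j).headD 0 = x)
    (j : Fin Q.numAtoms) :
    (openIters (atomsAt Q d) iters l j).map (fun l => l.headD 0) =
      revPath j (x :: fs.map Frame.key) := by
  subst hd
  simp only [openIters, revPath, List.length_map]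
  split_ifs with hj
  · rw [List.map_cons, h, hx j hj]
  · exact h j

lemma reaches_up (A : Q.Instance) {js queue : List (Fin Q.numAtoms)} (hq : queue.Perm js)
    (base : Fin Q.numAtoms → TrieIter) (l : Fin Q.numAtoms → List ℕ) (key : ℕ)
    (fs : List (Frame Q)) (tr₀ : List (Event Q)) :
    Reaches A ⟨openIters js base l, ⟨queue, key⟩ :: fs, .leave, tr₀⟩
      ⟨base, fs, if fs.isEmpty then .done else .advance,
        tr₀ ++ queue.map (fun j => Event.iter j .up) ++ [.ram]⟩ := by
  have s := Reaches.step A ⟨openIters js base l, ⟨queue, key⟩ :: fs, .leave, tr₀⟩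
  have e : (fun j => if j ∈ queue then (openIters js base l j).up else openIters js base l j) =
      base := by
    funext j
    simp only [openIters, hq.mem_iff]
    split_ifs <;> rfl
  simpa only [step, stepLeave, e] using s

lemma output_map_iter (js : List (Fin Q.numAtoms)) (f : Fin Q.numAtoms → IterOp) :
    output (js.map fun j => Event.iter j (f j)) = [] := by
  simp [output]

lemma output_replicate_ram (n : ℕ) : output (List.replicate n (.ram : Event Q)) = [] := by
  simp [output]

lemma joinInv_init (A : Q.Instance) {p : List ℕ} (hp : p.length < Q.numVars)
    (base : Fin Q.numAtoms → TrieIter) {js queue : List (Fin Q.numAtoms)}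
    (hjs : js = atomsAt Q p.length)
    (hne : ∀ j ∈ js, children A j p ≠ [])
    (hq : queue = js.insertionSort fun i j =>
      (openIters js base (fun j => children A j p) i).key ≤
        (openIters js base (fun j => children A j p) j).key) :
    ∃ jl, queue.getLast? = some jl ∧
      JoinInv js (fun j => children A j p) queue
        (openIters js base (fun j => children A j p) jl).key ((commonKeys A p).sort (· ≤ ·)) := by
  set it := openIters js base fun j => children A j p with hit
  have hkey : ∀ j ∈ js, (it j).key = (children A j p).headD 0 := fun j hj => by
    simp [hit, openIters_of_mem hj, TrieIter.key]
  have hperm : queue.Perm js := hq ▸ List.perm_insertionSort _ _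
  have : Std.Total fun i j => (it i).key ≤ (it j).key := ⟨fun i j => le_total _ _⟩
  have : IsTrans _ fun i j => (it i).key ≤ (it j).key := ⟨fun i j k => le_trans⟩
  have hpw : queue.Pairwise fun i j => (it i).key ≤ (it j).key :=
    hq ▸ List.pairwise_insertionSort _ _
  rcases List.eq_nil_or_concat queue with h0 | ⟨q', jl, hq'⟩
  · obtain ⟨j, hj⟩ := exists_mem_atomsAt hp
    rw [← hjs, ← hperm.mem_iff, h0] at hj
    simp at hj
  · have hjl : jl ∈ js := hperm.subset (by simp [hq'])
    refine ⟨jl, by simp [hq'], hperm, fun j _ => sorted_children A j p, hne, ?_, fun j hj => ?_,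
      ⟨jl, hjl, (hkey jl hjl).symm⟩, (Finset.sortedLT_sort _).pairwise, fun y => ?_⟩
    · refine hpw.imp_of_mem fun {a b} ha hb hab => ?_
      rwa [hkey a (hperm.subset ha), hkey b (hperm.subset hb)] at hab
    · rw [← hkey j hj]
      rw [← hperm.mem_iff, hq', List.concat_eq_append] at hj
      rw [hq', List.concat_eq_append, List.pairwise_append] at hpw
      rcases List.mem_append.1 hj with h | h
      · exact hpw.2.2 j h jl (by simp)
      · rw [List.mem_singleton.1 h]
    · rw [Finset.mem_sort, mem_commonKeys hp, hjs]

/-- The execution of leapfrog triejoin on the subtree below a node, given the executions `hres` for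
the children. -/
theorem reaches_of_enter_of_result (A : Q.Instance) (m : ℕ) (iters : Fin Q.numAtoms → TrieIter)
    (fs : List (Frame Q)) (tr₀ : List (Event Q)) (hlen : fs.length < Q.numVars)
    (hpath : ∀ j, (iters j).map (fun l => l.headD 0) = revPath j (fs.map Frame.key))
    (hres : ∀ queue l x tr₀, (∀ j ∈ atomsAt Q fs.length, (l j).headD 0 = x) →
      ∃ tr, Reaches A ⟨openIters (atomsAt Q fs.length) iters l, ⟨queue, x⟩ :: fs, .result, tr₀⟩
          ⟨openIters (atomsAt Q fs.length) iters l, ⟨queue, x⟩ :: fs, .advance, tr₀ ++ tr⟩ ∧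
        output tr = results A m (x :: fs.map Frame.key) ∧
        tr.length ≤ work A m (x :: fs.map Frame.key)) :
    ∃ tr, Reaches A ⟨iters, fs, .enter, tr₀⟩
        ⟨iters, fs, if fs.isEmpty then .done else .advance, tr₀ ++ tr⟩ ∧
      output tr = results A (m + 1) (fs.map Frame.key) ∧
      -- The spare event pays for the `.ram` step of `stepResult` that leads from the parent into
      -- this subtree.
      tr.length + 1 ≤ work A (m + 1) (fs.map Frame.key) := by
  have s1 := Reaches.step A ⟨iters, fs, .enter, tr₀⟩
  have hlen' : (fs.map Frame.key).length = fs.length := List.length_map _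
  have hp : (fs.map Frame.key).length < Q.numVars := hlen'.trans_lt hlen
  simp only [step, stepEnter, descend_iters A hpath] at s1
  set p := fs.map Frame.key with hpdef
  set js := atomsAt Q fs.length with hjs
  have hjs' : js = atomsAt Q p.length := by rw [hlen']
  have hjsl : js.length ≤ Q.numAtoms := length_atomsAt_le _
  have hsq : js.length ^ 2 ≤ Q.numAtoms ^ 2 := Nat.pow_le_pow_left hjsl 2
  have hany : (js.any fun j => (openIters js iters (fun j => children A j p) j).atEnd) = true ↔
      ∃ j ∈ js, children A j p = [] := by
    rw [List.any_eq_true]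
    refine exists_congr fun j => and_congr_right fun hj => ?_
    simp [openIters_of_mem hj, TrieIter.atEnd]
  by_cases he : ∃ j ∈ js, children A j p = []
  · rw [if_pos (hany.2 he)] at s1
    refine ⟨_, by simpa only [List.append_assoc] using s1.trans (reaches_up A (.refl _) _ _ _ _ _),
      ?_, ?_⟩
    · have hc : commonKeys A p = ∅ := by
        obtain ⟨j, hj, hj0⟩ := he
        refine Finset.eq_empty_of_forall_notMem fun y hy => ?_
        have := (mem_commonKeys hp).1 hy j (hjs' ▸ hj)
        simp [hj0] at this
      simp [output_append, output_map_iter, results, hc]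
    · simp only [List.length_append, List.length_map, List.length_singleton, work, nodeCost]
      refine le_trans ?_ ((Nat.le_mul_of_pos_right _ (by omega)).trans (Nat.le_add_right _ _))
      linarith [Nat.zero_le (Q.numAtoms ^ 2)]
  · have hne : ∀ j ∈ js, children A j p ≠ [] := fun j hj h0 => he ⟨j, hj, h0⟩
    rw [if_neg (fun h => he (hany.1 h))] at s1
    obtain ⟨jl, hjl, hinv⟩ := joinInv_init A hp iters hjs' hne rfl
    simp only [hjl, Option.map_some, Option.getD_some, Option.toList_some, List.map_cons,
      List.map_nil] at s1
    -- The potential is taken for an atom with the fewest keys. Its initial position is below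
    -- `js.length`, hence the budget `js.length * minChildren A p`.
    obtain ⟨j₀, hj₀, hmin⟩ := exists_length_eq_minChildren A hp
    rw [← hjs', ← hinv.perm.mem_iff] at hj₀
    obtain ⟨pre, post, hsplit⟩ := List.append_of_mem hj₀
    have hpre : pre.length + 1 ≤ js.length := by
      rw [← hinv.perm.length_eq, hsplit]; simp
    obtain ⟨tr₁, queue', l', key', s2, hperm, ho, hl⟩ := reaches_leave A (nodup_atomsAt _) iters fs
      (fun y => results A m (y :: p)) (fun y => work A m (y :: p)) j₀ hres
      (js.length * minChildren A p) _ _ 0 _ _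
      (tr₀ ++ (js.map (fun j => Event.iter j .descend) ++ js.map (fun j => Event.iter j .atEnd)) ++
        js.map (fun j => Event.iter j .key) ++ List.replicate (js.length ^ 2) .ram ++
        [Event.iter jl .key]) pre post hinv hsplit (by rw [hmin, ← hjs]; omega)
    have s3 := (s1.trans s2).trans (reaches_up A hperm _ _ _ _ _)
    refine ⟨_, by simpa only [List.append_assoc] using s3, ?_, ?_⟩
    · simp [output_append, output_map_iter, output_replicate_ram, results, ho]
    · have hq := hperm.length_eq
      rw [sum_map_sort] at hl
      have h1 : js.length * minChildren A p ≤ Q.numAtoms * minChildren A p :=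
        Nat.mul_le_mul_right _ hjsl
      simp only [List.length_append, List.length_map, List.length_singleton,
        List.length_replicate, work, nodeCost, hq]
      nlinarith [Nat.zero_le (Q.numAtoms ^ 2 * minChildren A p)]

/-- The execution of leapfrog triejoin on the subtree below a node. -/
theorem reaches_of_enter (A : Q.Instance) (m : ℕ) :
    ∀ (iters : Fin Q.numAtoms → TrieIter) (fs : List (Frame Q)) (tr₀ : List (Event Q)),
      fs.length + (m + 1) = Q.numVars →
      (∀ j, (iters j).map (fun l => l.headD 0) = revPath j (fs.map Frame.key)) →
      ∃ tr, Reaches A ⟨iters, fs, .enter, tr₀⟩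
          ⟨iters, fs, if fs.isEmpty then .done else .advance, tr₀ ++ tr⟩ ∧
        output tr = results A (m + 1) (fs.map Frame.key) ∧
        tr.length + 1 ≤ work A (m + 1) (fs.map Frame.key) := by
  induction m with
  | zero =>
    intro iters fs tr₀ hlen hpath
    refine reaches_of_enter_of_result A 0 iters fs tr₀ (by omega) hpath fun queue l x tr₁ _ => ?_
    have s := Reaches.step A
      ⟨openIters (atomsAt Q fs.length) iters l, ⟨queue, x⟩ :: fs, .result, tr₁⟩
    simp only [step, stepResult, List.length_cons, hlen, if_true] at s
    exact ⟨_, s, rfl, by simp [work, nodeCost]⟩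
  | succ m ih =>
    intro iters fs tr₀ hlen hpath
    refine reaches_of_enter_of_result A (m + 1) iters fs tr₀ (by omega) hpath
      fun queue l x tr₁ hx => ?_
    have s := Reaches.step A
      ⟨openIters (atomsAt Q fs.length) iters l, ⟨queue, x⟩ :: fs, .result, tr₁⟩
    simp only [step, stepResult, List.length_cons] at s
    rw [if_neg (by omega)] at s
    obtain ⟨tr, s', ho, hl⟩ := ih (openIters (atomsAt Q fs.length) iters l) (⟨queue, x⟩ :: fs)
      (tr₁ ++ [.ram]) (by simp only [List.length_cons]; omega)
      (map_headD_openIters rfl hpath hx)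
    refine ⟨[.ram] ++ tr, by simpa [List.append_assoc] using s.trans s', ?_, ?_⟩
    · simpa using ho
    · simpa using hl

/-- Leapfrog triejoin terminates. -/
theorem exists_leapfrogTriejoin (A : Q.Instance) :
    ∃ tr, LeapfrogTriejoin A tr ∧ output tr = results A Q.numVars [] ∧
      tr.length ≤ work A Q.numVars [] := by
  obtain ⟨m, hm⟩ : ∃ m, Q.numVars = m + 1 := ⟨Q.numVars - 1, by have := Q.numVars_pos; omega⟩
  obtain ⟨tr, h, ho, hl⟩ := reaches_of_enter A m (fun _ => []) [] [] (by simp [hm]) fun _ => rfl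
  obtain ⟨t, ht⟩ := h.exists_iterate
  rw [hm]
  refine ⟨tr, ⟨t, ?_⟩, ho, by simpa using (Nat.le_succ _).trans hl⟩
  rw [initConfig, ht]
  exact ⟨rfl, rfl⟩

lemma iterate_step_of_done {A : Q.Instance} {c : Config Q} (h : c.phase = .done) (t : ℕ) :
    (step A)^[t] c = c :=
  Function.iterate_fixed (by simp [step, h]) t

/-- `step` is a function that fixes states in phase `.done`, so the longer of two completed runs
adds nothing to the shorter. -/
lemma LeapfrogTriejoin.unique {A : Q.Instance} {tr tr' : List (Event Q)}
    (h : LeapfrogTriejoin A tr) (h' : LeapfrogTriejoin A tr') : tr = tr' := by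
  obtain ⟨t, hd, rfl⟩ := h
  obtain ⟨t', hd', rfl⟩ := h'
  rcases le_total t t' with ht | ht
  · obtain ⟨s, rfl⟩ := Nat.exists_eq_add_of_le' ht
    rw [Function.iterate_add_apply, iterate_step_of_done hd]
  · obtain ⟨s, rfl⟩ := Nat.exists_eq_add_of_le' ht
    rw [Function.iterate_add_apply, iterate_step_of_done hd']

/-! ## Correctness of the search tree -/

lemma assignmentOf_of_le {p : List ℕ} {v : Fin Q.numVars} (h : p.length ≤ v) :
    assignmentOf Q p v = 0 := by
  rw [assignmentOf, List.getD_eq_default _ _ (by simpa using h)]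

lemma assignmentOf_cons_of_lt {p : List ℕ} {y : ℕ} {v : Fin Q.numVars} (h : (v : ℕ) < p.length) :
    assignmentOf Q (y :: p) v = assignmentOf Q p v := by
  rw [assignmentOf, assignmentOf, List.reverse_cons, List.getD_append _ _ _ _ (by simpa using h)]

lemma assignmentOf_cons_of_eq {p : List ℕ} {y : ℕ} {v : Fin Q.numVars} (h : (v : ℕ) = p.length) :
    assignmentOf Q (y :: p) v = y := by
  rw [assignmentOf, List.reverse_cons, List.getD_append_right _ _ _ _ (by simp [h])]
  simp [h]

lemma assignmentOf_inj {p p' : List ℕ} (hl : p.length = p'.length) (hp : p.length ≤ Q.numVars)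
    (h : assignmentOf Q p = assignmentOf Q p') : p = p' := by
  refine List.reverse_injective (List.ext_getElem (by simpa using hl) fun i h₁ h₂ => ?_)
  have := congrFun h ⟨i, by simp at h₁; omega⟩
  simpa only [assignmentOf, List.getD_eq_getElem _ _ h₁, List.getD_eq_getElem _ _ h₂] using this

lemma args_lt_args {j : Fin Q.numAtoms} {e e' : Fin (Q.arity j)} :
    (Q.args j e : ℕ) < Q.args j e' ↔ e < e' := (Q.args j).lt_iff_lt

lemma args_inj {j : Fin Q.numAtoms} {e e' : Fin (Q.arity j)}
    (h : (Q.args j e : ℕ) = Q.args j e') : e = e' := (Q.args j).injective (Fin.ext h)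

/-- The arguments of an atom follow the variable ordering, so its bound positions form an initial
segment, and the path lists the values bound there. -/
lemma revPath_spec (j : Fin Q.numAtoms) (p : List ℕ) :
    (revPath j p).length ≤ Q.arity j ∧
      (∀ e : Fin (Q.arity j), (e : ℕ) < (revPath j p).length ↔ (Q.args j e : ℕ) < p.length) ∧
      ∀ e : Fin (Q.arity j), (Q.args j e : ℕ) < p.length →
        (revPath j p).reverse[(e : ℕ)]? = some (assignmentOf Q p (Q.args j e)) := by
  induction p with
  | nil => simp [revPath]
  | cons y p ih =>
    obtain ⟨h₁, h₂, h₃⟩ := ih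
    by_cases hj : j ∈ atomsAt Q p.length
    · obtain ⟨e, he⟩ := mem_atomsAt.1 hj
      have hlen : (revPath j p).length = e := by
        refine le_antisymm (not_lt.1 fun h => ?_) (not_lt.1 fun h => ?_)
        · have := (h₂ e).1 h
          omega
        · have h' : (⟨(revPath j p).length, h.trans e.2⟩ : Fin (Q.arity j)) < e := h
          exact lt_irrefl _ ((h₂ _).2 (he ▸ args_lt_args.2 h'))
      simp only [revPath, hj, if_true, List.length_cons, List.reverse_cons]
      have key : ∀ e' : Fin (Q.arity j), (Q.args j e' : ℕ) < p.length + 1 ↔ e' ≤ e := fun e' => by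
        rw [Nat.lt_succ_iff, ← he, ← not_lt, args_lt_args, not_lt]
      refine ⟨by have := e.2; omega, fun e' => by rw [key, hlen, Nat.lt_succ_iff, Fin.le_def],
        fun e' he' => ?_⟩
      rcases (Nat.lt_succ_iff.1 he').lt_or_eq with h | h
      · rw [List.getElem?_append_left (by simpa using (h₂ e').2 h), h₃ e' h,
          assignmentOf_cons_of_lt h]
      · obtain rfl := args_inj (h.trans he.symm)
        rw [assignmentOf_cons_of_eq h, List.getElem?_append_right (by simp [hlen])]
        simp [hlen]
    · have hne : ∀ e : Fin (Q.arity j), (Q.args j e : ℕ) ≠ p.length := fun e he =>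
        hj (mem_atomsAt.2 ⟨e, he⟩)
      have key : ∀ e' : Fin (Q.arity j), (Q.args j e' : ℕ) < p.length + 1 ↔
          (Q.args j e' : ℕ) < p.length := fun e' => by have := hne e'; omega
      simp only [revPath, hj, if_false, List.length_cons]
      refine ⟨h₁, fun e' => by rw [h₂, key], fun e' he' => ?_⟩
      rw [h₃ e' ((key e').1 he'), assignmentOf_cons_of_lt ((key e').1 he')]

/-- Replaces trie paths by agreement of tuples with the bindings; later arguments use only this
description. -/
lemma mem_children {A : Q.Instance} {j : Fin Q.numAtoms} {e : Fin (Q.arity j)} {p : List ℕ}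
    (he : (Q.args j e : ℕ) = p.length) {y : ℕ} :
    y ∈ children A j p ↔
      ∃ t ∈ A j, (∀ e' < e, t e' = assignmentOf Q p (Q.args j e')) ∧ t e = y := by
  obtain ⟨h₁, h₂, h₃⟩ := revPath_spec j p
  have hlt : ∀ e', (Q.args j e' : ℕ) < p.length ↔ e' < e := fun e' => by rw [← he, args_lt_args]
  have hlen : (revPath j p).length = e := by
    refine le_antisymm (not_lt.1 fun h => ?_) (not_lt.1 fun h => ?_)
    · exact lt_irrefl _ ((hlt e).1 ((h₂ e).1 h))
    · have h' : (⟨(revPath j p).length, h.trans e.2⟩ : Fin (Q.arity j)) < e := h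
      exact lt_irrefl _ ((h₂ _).2 ((hlt _).2 h'))
  simp only [children, trieChildren, Finset.mem_sort, Finset.mem_image, Finset.mem_filter,
    List.length_reverse, hlen, and_assoc]
  refine exists_congr fun t => and_congr_right fun _ => and_congr ⟨fun h e' he' => ?_, fun h => ?_⟩ ?_
  · have := h₃ e' ((hlt e').2 he')
    rw [← h, List.getElem?_take_of_lt (by exact he')] at this
    simpa using this
  · refine List.ext_getElem? fun i => ?_
    by_cases hi : i < e
    · rw [List.getElem?_take_of_lt hi, h₃ ⟨i, hi.trans e.2⟩ ((hlt _).2 hi), ← h ⟨i, _⟩ hi]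
      simp [hi.trans e.2]
    · rw [List.getElem?_eq_none (by simp; omega), List.getElem?_eq_none (by simp; omega)]
  · simp

lemma mem_commonKeys_iff {A : Q.Instance} {p : List ℕ} (hp : p.length < Q.numVars) {y : ℕ} :
    y ∈ commonKeys A p ↔ ∀ j e, (Q.args j e : ℕ) = p.length →
      ∃ t ∈ A j, (∀ e' < e, t e' = assignmentOf Q p (Q.args j e')) ∧ t e = y := by
  rw [mem_commonKeys hp]
  refine forall_congr' fun j => ⟨fun h e he => (mem_children he).1 (h (mem_atomsAt.2 ⟨e, he⟩)),
    fun h hj => ?_⟩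
  obtain ⟨e, he⟩ := mem_atomsAt.1 hj
  exact (mem_children he).2 (h e he)

/-- Binding a variable checks, for each atom containing it, that some tuple matches the assignment
up to that position. The tuple may change from position to position; the one for the last position
matches everywhere. -/
lemma mem_results {A : Q.Instance} {x : Q.Assignment} (m : ℕ) :
    ∀ p : List ℕ, p.length + m = Q.numVars → (x ∈ results A m p ↔
      (∀ v : Fin Q.numVars, (v : ℕ) < p.length → x v = assignmentOf Q p v) ∧
      ∀ j e, p.length ≤ (Q.args j e : ℕ) → ∃ t ∈ A j, ∀ e' ≤ e, t e' = x (Q.args j e')) := by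
  induction m with
  | zero =>
    intro p hp
    rw [results, List.mem_singleton, funext_iff]
    constructor
    · exact fun h => ⟨fun v _ => h v, fun j e he => absurd (Q.args j e).2 (by omega)⟩
    · exact fun h v => h.1 v (by have := v.2; omega)
  | succ m ih =>
    intro p hp
    have hp' : p.length < Q.numVars := by omega
    have hlt : ∀ {j : Fin Q.numAtoms} {e e' : Fin (Q.arity j)},
        (Q.args j e : ℕ) = p.length → e' < e → (Q.args j e' : ℕ) < p.length :=
      fun he h => he ▸ args_lt_args.2 h
    simp only [results, List.mem_flatMap, Finset.mem_sort]
    constructor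
    · rintro ⟨y, hy, hx⟩
      obtain ⟨h₁, h₂⟩ := (ih (y :: p) (by simp; omega)).1 hx
      have h₁' : ∀ v : Fin Q.numVars, (v : ℕ) < p.length → x v = assignmentOf Q p v :=
        fun v hv => by rw [h₁ v (by simp; omega), assignmentOf_cons_of_lt hv]
      refine ⟨h₁', fun j e he => ?_⟩
      rcases he.eq_or_lt with he | he
      · obtain ⟨t, ht, h₃, h₄⟩ := (mem_commonKeys_iff hp').1 hy j e he.symm
        refine ⟨t, ht, fun e' he' => ?_⟩
        rcases he'.eq_or_lt with rfl | he'
        · rw [h₄, h₁ _ (by simp; omega), assignmentOf_cons_of_eq he.symm]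
        · rw [h₃ e' he', h₁' _ (hlt he.symm he')]
      · exact h₂ j e he
    · rintro ⟨h₁, h₂⟩
      refine ⟨x ⟨p.length, hp'⟩, (mem_commonKeys_iff hp').2 fun j e he => ?_,
        (ih _ (by simp; omega)).2 ⟨fun v hv => ?_, fun j e he => h₂ j e ?_⟩⟩
      · obtain ⟨t, ht, h₃⟩ := h₂ j e he.ge
        refine ⟨t, ht, fun e' he' => ?_, ?_⟩
        · rw [h₃ e' he'.le, h₁ _ (hlt he he')]
        · rw [h₃ e le_rfl]
          exact congrArg x (Fin.ext he)
      · rcases (Nat.lt_succ_iff.1 hv).lt_or_eq with hv | hv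
        · rw [assignmentOf_cons_of_lt hv, h₁ v hv]
        · rw [assignmentOf_cons_of_eq hv]
          exact congrArg x (Fin.ext hv)
      · simp only [List.length_cons] at he
        omega

/-- Outputs below different children differ in the variable number `p.length`. -/
lemma nodup_results (A : Q.Instance) (m : ℕ) :
    ∀ p : List ℕ, p.length + m = Q.numVars → (results A m p).Nodup := by
  induction m with
  | zero => exact fun p _ => List.nodup_singleton _
  | succ m ih =>
    intro p hp
    refine List.nodup_flatMap.2 ⟨fun y _ => ih _ (by simp; omega),
      (Finset.sort_nodup _ _).imp fun {y y'} hne x hx hx' => hne ?_⟩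
    have h := ((mem_results m _ (by simp; omega)).1 hx).1 ⟨p.length, by omega⟩ (by simp)
    have h' := ((mem_results m _ (by simp; omega)).1 hx').1 ⟨p.length, by omega⟩ (by simp)
    rw [assignmentOf_cons_of_eq rfl] at h h'
    exact h.symm.trans h'

lemma mem_results_iff_mem_answers {A : Q.Instance} {x : Q.Assignment} :
    x ∈ results A Q.numVars [] ↔ x ∈ answers A := by
  rw [mem_results _ _ (by simp)]
  constructor
  · rintro ⟨-, h⟩ j
    have := Q.arity_pos j
    -- At the last position the matching prefix is the whole tuple.
    obtain ⟨t, ht, h'⟩ := h j ⟨Q.arity j - 1, by omega⟩ (by simp)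
    convert ht using 1
    funext e
    exact (h' e (Fin.le_def.2 (by have := e.2; simp only; omega))).symm
  · exact fun h => ⟨by simp, fun j e _ => ⟨_, h j, fun _ _ => rfl⟩⟩

/-! ## The levels of the search tree -/

/-- The nodes of the search tree at depth `d`. -/
def level (A : Q.Instance) : ℕ → Finset (List ℕ)
  | 0 => {[]}
  | d + 1 => (level A d).biUnion fun p => (commonKeys A p).image (· :: p)

lemma length_of_mem_level {A : Q.Instance} {d : ℕ} :
    ∀ {p : List ℕ}, p ∈ level A d → p.length = d := by
  induction d with
  | zero => simp [level]
  | succ d ih =>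
    intro p hp
    simp only [level, Finset.mem_biUnion, Finset.mem_image] at hp
    obtain ⟨p, hp, y, -, rfl⟩ := hp
    simp [ih hp]

lemma sum_level_succ (A : Q.Instance) (d : ℕ) (f : List ℕ → ℕ) :
    ∑ p ∈ level A (d + 1), f p = ∑ p ∈ level A d, ∑ y ∈ commonKeys A p, f (y :: p) := by
  rw [level, Finset.sum_biUnion]
  · refine Finset.sum_congr rfl fun p _ => Finset.sum_image fun a _ b _ h => ?_
    exact (List.cons.inj h).1
  · intro p _ p' _ hne
    refine Finset.disjoint_left.2 fun z hz hz' => hne ?_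
    simp only [Finset.mem_image] at hz hz'
    obtain ⟨a, -, rfl⟩ := hz
    obtain ⟨b, -, h⟩ := hz'
    exact (List.cons.inj h).2.symm

lemma card_commonKeys_le (A : Q.Instance) {p : List ℕ} (hp : p.length < Q.numVars) :
    (commonKeys A p).card ≤ minChildren A p := by
  obtain ⟨j, hj, h⟩ := exists_length_eq_minChildren A hp
  rw [← h]
  refine (Finset.card_le_card fun y hy => ?_).trans (List.toFinset_card_le _)
  exact List.mem_toFinset.2 ((mem_commonKeys hp).1 hy j hj)

/-- The children of a node are common keys, hence at most `minChildren` many; the root is covered by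
`0 < q`. -/
lemma card_level_le {A : Q.Instance} {q : ℕ} (hq : 0 < q)
    (h : ∀ d < Q.numVars, ∑ p ∈ level A d, minChildren A p ≤ q) {d : ℕ} (hd : d ≤ Q.numVars) :
    (level A d).card ≤ q := by
  cases d with
  | zero => exact hq
  | succ d =>
    rw [Finset.card_eq_sum_ones, sum_level_succ]
    refine (Finset.sum_le_sum fun p hp => ?_).trans (h d hd)
    rw [← Finset.card_eq_sum_ones]
    exact card_commonKeys_le A (by rw [length_of_mem_level hp]; omega)

/-- Each of the `m` remaining depths contributes `q` for its nodes and `q` for their keys, and the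
complete assignments contribute one more `q`. -/
lemma sum_work_le {A : Q.Instance} {q : ℕ} (hq : 0 < q)
    (h : ∀ d < Q.numVars, ∑ p ∈ level A d, minChildren A p ≤ q) (m : ℕ) :
    ∀ d, d + m = Q.numVars → ∑ p ∈ level A d, work A m p ≤ nodeCost Q * (q * (2 * m + 1)) := by
  induction m with
  | zero =>
    intro d hd
    have := card_level_le hq h (d := d) (by omega)
    simpa [work, mul_comm] using Nat.mul_le_mul_left (nodeCost Q) this
  | succ m ih =>
    intro d hd
    simp only [work, Finset.sum_add_distrib, ← Finset.mul_sum]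
    rw [← sum_level_succ A d (work A m), ← Finset.card_eq_sum_ones]
    have h₁ := card_level_le hq h (d := d) (by omega)
    have h₂ := h d (by omega)
    have h₃ := Nat.mul_le_mul_left (nodeCost Q) (add_le_add h₁ h₂)
    have h₄ := ih (d + 1) (by omega)
    calc _ ≤ _ := add_le_add h₃ h₄
      _ = _ := by ring

/-- The value of the last bound variable of the atom was a common key, which already required a
tuple agreeing with all earlier bindings. -/
lemma exists_mem_of_mem_level {A : Q.Instance} (j : Fin Q.numAtoms) {d : ℕ} :
    d ≤ Q.numVars → ∀ {p : List ℕ}, p ∈ level A d →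
    (∀ e, d ≤ (Q.args j e : ℕ)) ∨
      ∃ t ∈ A j, ∀ e, (Q.args j e : ℕ) < d → t e = assignmentOf Q p (Q.args j e) := by
  induction d with
  | zero => exact fun _ _ _ => .inl fun _ => Nat.zero_le _
  | succ d ih =>
    intro hd p hp
    simp only [level, Finset.mem_biUnion, Finset.mem_image] at hp
    obtain ⟨p, hp, y, hy, rfl⟩ := hp
    have hl := length_of_mem_level hp
    by_cases hj : ∃ e, (Q.args j e : ℕ) = d
    · obtain ⟨e, he⟩ := hj
      obtain ⟨t, ht, h₁, h₂⟩ := (mem_commonKeys_iff (by omega)).1 hy j e (he.trans hl.symm)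
      refine .inr ⟨t, ht, fun e' he' => ?_⟩
      rcases (Nat.lt_succ_iff.1 he').lt_or_eq with h | h
      · rw [assignmentOf_cons_of_lt (by omega), h₁ e' (args_lt_args.1 (by omega))]
      · obtain rfl := args_inj (h.trans he.symm)
        rw [assignmentOf_cons_of_eq (by omega), h₂]
    · push Not at hj
      rcases ih (by omega) hp with h | ⟨t, ht, h⟩
      · exact .inl fun e => by have := h e; have := hj e; omega
      · refine .inr ⟨t, ht, fun e he => ?_⟩
        have := hj e
        rw [h e (by omega), assignmentOf_cons_of_lt (by omega)]

/-! ## The renumbering transformation -/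

/-- The number of elements of `U` below `y`. -/
def rank (U : Finset ℕ) (y : ℕ) : ℕ := (U.filter (· < y)).card

lemma rank_lt_card {U : Finset ℕ} {y : ℕ} (hy : y ∈ U) : rank U y < U.card :=
  Finset.card_lt_card (Finset.filter_ssubset.2 ⟨y, hy, lt_irrefl y⟩)

lemma rank_lt_rank {U : Finset ℕ} {y z : ℕ} (hy : y ∈ U) (h : y < z) : rank U y < rank U z :=
  Finset.card_lt_card (Finset.ssubset_iff_of_subset
    (Finset.monotone_filter_right U fun _ _ ha => lt_trans ha h) |>.2 ⟨y, by simp [hy, h], by simp⟩)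

lemma exists_rank_eq {U : Finset ℕ} {r : ℕ} (hr : r < U.card) : ∃ z ∈ U, rank U z = r := by
  have hinj : Set.InjOn (rank U) U := fun a ha b hb hab => by
    rcases lt_trichotomy a b with h | h | h
    · exact absurd hab (rank_lt_rank ha h).ne
    · exact h
    · exact absurd hab (rank_lt_rank hb h).ne'
  have himg : U.image (rank U) = Finset.range U.card :=
    Finset.eq_of_subset_of_card_le
      (fun r hr => by
        obtain ⟨y, hy, rfl⟩ := Finset.mem_image.1 hr
        exact Finset.mem_range.2 (rank_lt_card hy))
      (by rw [Finset.card_image_of_injOn hinj, Finset.card_range])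
  have := Finset.mem_range.2 hr
  rw [← himg] at this
  simpa using this

/-- The values at position `e` of the tuples of `R` which agree with `s` on the positions in `cols`
before `e`. -/
def siblings {a : ℕ} (R : Finset (Fin a → ℕ)) (cols : Finset (Fin a)) (s : {e // e ∈ cols} → ℕ)
    (e : Fin a) : Finset ℕ :=
  (R.filter fun t => ∀ e' : {e // e ∈ cols}, e'.1 < e → t e' = s e').image (· e)

lemma mem_siblings {a : ℕ} {R : Finset (Fin a → ℕ)} {cols : Finset (Fin a)}
    {s : {e // e ∈ cols} → ℕ} {e : Fin a} {y : ℕ} :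
    y ∈ siblings R cols s e ↔
      ∃ t ∈ R, (∀ e' : {e // e ∈ cols}, e'.1 < e → t e' = s e') ∧ t e = y := by
  simp [siblings, and_assoc]

lemma siblings_congr {a : ℕ} {R : Finset (Fin a → ℕ)} {cols : Finset (Fin a)}
    {s s' : {e // e ∈ cols} → ℕ} {e : Fin a} (h : ∀ e', e'.1 < e → s e' = s' e') :
    siblings R cols s e = siblings R cols s' e := by
  ext y
  rw [mem_siblings, mem_siblings]
  exact exists_congr fun t => and_congr_right fun _ => and_congr_left fun _ =>
    forall_congr' fun e' => forall_congr' fun he => by rw [h e' he]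

/-- Renumbering of the values of the variable number `d` among siblings; later variables get the
value `0`. -/
def renumberCols (A : Q.Instance) (d : ℕ) (j : Fin Q.numAtoms) (cols : Finset (Fin (Q.arity j)))
    (s : {e // e ∈ cols} → ℕ) (e : {e // e ∈ cols}) : ℕ :=
  if (Q.args j e : ℕ) < d then s e
  else if (Q.args j e : ℕ) = d then rank (siblings (A j) cols s e) (s e) else 0

/-- Renumbering of a complete tuple. -/
def renumberTuple (A : Q.Instance) (d : ℕ) (j : Fin Q.numAtoms) (t : Fin (Q.arity j) → ℕ)
    (e : Fin (Q.arity j)) : ℕ :=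
  renumberCols A d j Finset.univ (fun e => t e) ⟨e, Finset.mem_univ e⟩

/-- The renumbered instance. Empty relations are replaced by the relation `{0}`. -/
def renumber (A : Q.Instance) (d : ℕ) : Q.Instance := fun j =>
  if A j = ∅ then {0} else (A j).image (renumberTuple A d j)

/-- Forgetting columns only enlarges the set of siblings. The rank of `t e₀` among its siblings is
thus also the rank of some `z` among the siblings in the projection, and a tuple with value `z` at
`e₀` supplies `w`. Later columns become `0` and do not matter. -/
lemma proj_renumberTuple_subset (A : Q.Instance) (d : ℕ) (j : Fin Q.numAtoms)
    (cols : Finset (Fin (Q.arity j))) {t : Fin (Q.arity j) → ℕ} (ht : t ∈ A j) :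
    ∃ w ∈ proj A j cols, renumberCols A d j cols w = fun e => renumberTuple A d j t e.1 := by
  by_cases h : ∃ e₀ : {e // e ∈ cols}, (Q.args j e₀ : ℕ) = d
  · obtain ⟨e₀, he₀⟩ := h
    set U := siblings (A j) cols (fun e => t e) e₀ with hU
    have hsub : siblings (A j) Finset.univ (fun e => t e) e₀ ⊆ U := fun y hy => by
      obtain ⟨t', ht', h₁, h₂⟩ := mem_siblings.1 hy
      exact mem_siblings.2 ⟨t', ht', fun e' he' => h₁ ⟨e'.1, Finset.mem_univ _⟩ he', h₂⟩
    have hr : rank (siblings (A j) Finset.univ (fun e => t e) e₀) (t e₀) < U.card :=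
      (rank_lt_card (mem_siblings.2 ⟨t, ht, fun _ _ => rfl, rfl⟩)).trans_le
        (Finset.card_le_card hsub)
    obtain ⟨z, hz, hzr⟩ := exists_rank_eq hr
    obtain ⟨t', ht', h₁, rfl⟩ := mem_siblings.1 hz
    refine ⟨fun e => t' e, Finset.mem_image_of_mem _ ht', funext fun e => ?_⟩
    simp only [renumberTuple, renumberCols]
    split_ifs with he he
    · exact h₁ e (args_lt_args.1 (he.trans_eq he₀.symm))
    · obtain rfl : e = e₀ := Subtype.ext (args_inj (he.trans he₀.symm))
      rw [← hzr, siblings_congr h₁]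
    · rfl
  · push Not at h
    refine ⟨fun e => t e, Finset.mem_image_of_mem _ ht, funext fun e => ?_⟩
    simp only [renumberTuple, renumberCols, h e, if_false]

lemma card_proj_renumber_le (A : Q.Instance) (d : ℕ) (j : Fin Q.numAtoms)
    (cols : Finset (Fin (Q.arity j))) :
    (proj (renumber A d) j cols).card ≤ max 1 (proj A j cols).card := by
  by_cases hA : A j = ∅
  · simp [proj, renumber, hA]
  · refine ((Finset.card_le_card fun w hw => ?_).trans
      (Finset.card_image_le (f := renumberCols A d j cols))).trans (le_max_right _ _)
    simp only [proj, renumber, hA, if_false, Finset.mem_image] at hw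
    obtain ⟨_, ⟨t, ht, rfl⟩, rfl⟩ := hw
    obtain ⟨w, hw, h⟩ := proj_renumberTuple_subset A d j cols ht
    exact Finset.mem_image.2 ⟨w, hw, h⟩

lemma siblings_eq_children {A : Q.Instance} {j : Fin Q.numAtoms} {e : Fin (Q.arity j)} {p : List ℕ}
    (he : (Q.args j e : ℕ) = p.length) {t : Fin (Q.arity j) → ℕ}
    (ht : ∀ e' < e, t e' = assignmentOf Q p (Q.args j e')) :
    siblings (A j) Finset.univ (fun e => t e) e = (children A j p).toFinset := by
  ext y
  rw [mem_siblings, List.mem_toFinset, mem_children he]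
  refine exists_congr fun t' => and_congr_right fun _ => and_congr_left fun _ =>
    ⟨fun h e' he' => ?_, fun h e' he' => ?_⟩
  · rw [← ht e' he', h ⟨e', Finset.mem_univ _⟩ he']
  · rw [ht e' he', h e' he']

/-- An atom containing variable `d` offers more than `r` keys at `p`, and a tuple for the key of
rank `r` is renumbered to the required one. For other atoms any tuple agreeing with `p` will do. The
zeros at later variables match the default of `assignmentOf`. -/
lemma assignmentOf_mem_answers_renumber {A : Q.Instance} {p : List ℕ} {d r : ℕ}
    (hd : d < Q.numVars) (hp : p ∈ level A d) (hr : r < minChildren A p) :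
    assignmentOf Q (r :: p) ∈ answers (renumber A d) := by
  have hl := length_of_mem_level hp
  subst hl
  intro j
  -- An empty relation can only belong to an atom whose variables all come after `d`: a bound
  -- variable requires a tuple, and at `d` the atom would offer no key although `r < minChildren A
  -- p`.
  have hnil : A j = ∅ → (fun e => assignmentOf Q (r :: p) (Q.args j e)) = 0 := fun hA => by
    funext e
    have hle : ∀ e, p.length ≤ (Q.args j e : ℕ) := by
      rcases exists_mem_of_mem_level j hd.le hp with h | ⟨t, ht, -⟩
      · exact h
      · simp [hA] at ht
    refine assignmentOf_of_le (Nat.succ_le_of_lt (lt_of_le_of_ne (hle e) fun he => ?_))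
    have h0 := hr.trans_le (minChildren_le A (mem_atomsAt.2 ⟨e, he.symm⟩))
    obtain ⟨y, hy⟩ := List.exists_mem_of_length_pos ((Nat.zero_le _).trans_lt h0)
    obtain ⟨t, ht, -⟩ := (mem_children he.symm).1 hy
    simp [hA] at ht
  by_cases hA : A j = ∅
  · simp [renumber, hA, hnil hA]
  · simp only [renumber, hA, if_false, Finset.mem_image]
    by_cases h : ∃ e, (Q.args j e : ℕ) = p.length
    · obtain ⟨e, he⟩ := h
      have hr' := hr.trans_le (minChildren_le A (mem_atomsAt.2 ⟨e, he⟩))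
      rw [← List.toFinset_card_of_nodup ((sorted_children A j p).imp fun h => h.ne)] at hr'
      obtain ⟨z, hz, rfl⟩ := exists_rank_eq hr'
      obtain ⟨t, ht, h₁, rfl⟩ := (mem_children he).1 (List.mem_toFinset.1 hz)
      refine ⟨t, ht, funext fun e' => ?_⟩
      simp only [renumberTuple, renumberCols]
      split_ifs with he' he'
      · rw [assignmentOf_cons_of_lt he', h₁ e' (args_lt_args.1 (he'.trans_eq he.symm))]
      · obtain rfl := args_inj (he'.trans he.symm)
        rw [assignmentOf_cons_of_eq he, siblings_eq_children he h₁]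
      · exact (assignmentOf_of_le (by simp; omega)).symm
    · push Not at h
      obtain ⟨t, ht, h₁⟩ : ∃ t ∈ A j, ∀ e, (Q.args j e : ℕ) < p.length →
          t e = assignmentOf Q p (Q.args j e) := by
        rcases exists_mem_of_mem_level j hd.le hp with h' | h'
        · obtain ⟨t, ht⟩ := Finset.nonempty_iff_ne_empty.2 hA
          exact ⟨t, ht, fun e he => absurd (h' e) (not_le.2 he)⟩
        · exact h'
      refine ⟨t, ht, funext fun e => ?_⟩
      have hne := h e
      simp only [renumberTuple, renumberCols, hne, if_false]
      split_ifs with he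
      · rw [assignmentOf_cons_of_lt he, h₁ e he]
      · exact (assignmentOf_of_le (by simp; omega)).symm

lemma sum_minChildren_le (A : Q.Instance) {d q : ℕ} (hd : d < Q.numVars)
    (hq : (answers (renumber A d)).encard ≤ q) : ∑ p ∈ level A d, minChildren A p ≤ q := by
  have hinj : Set.InjOn (fun x : (_ : List ℕ) × ℕ => assignmentOf Q (x.2 :: x.1))
      ((level A d).sigma fun p => Finset.range (minChildren A p)) := by
    rintro ⟨p, r⟩ hx ⟨p', r'⟩ hx' h
    simp only [Finset.coe_sigma, Set.mem_sigma_iff, Finset.mem_coe] at hx hx'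
    have hl := length_of_mem_level hx.1
    have hl' := length_of_mem_level hx'.1
    obtain ⟨rfl, rfl⟩ := List.cons.inj (assignmentOf_inj (by simp [hl, hl']) (by simp; omega) h)
    rfl
  have hcard := Finset.card_image_of_injOn hinj
  rw [Finset.card_sigma] at hcard
  simp only [Finset.card_range] at hcard
  rw [← hcard]
  have hsub : (((level A d).sigma fun p => Finset.range (minChildren A p)).image
      (fun x : (_ : List ℕ) × ℕ => assignmentOf Q (x.2 :: x.1)) : Set Q.Assignment) ⊆
      answers (renumber A d) := by
    intro x hx
    obtain ⟨⟨p, r⟩, hpr, rfl⟩ := Finset.mem_image.1 (Finset.mem_coe.1 hx)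
    simp only [Finset.mem_sigma, Finset.mem_range] at hpr
    exact assignmentOf_mem_answers_renumber hd hpr.1 hpr.2
  have := (Set.encard_le_encard hsub).trans hq
  rw [Set.encard_coe_eq_coe_finsetCard] at this
  exact_mod_cast this

/-! ## Families of problem instances -/

/-- An instance with an answer has only nonempty projections, so every bound is at least `1`; this
absorbs the singletons that replace empty relations. -/
lemma renumber_mem_inst {P : Type*} [Preorder P] {F : ProblemFamily Q P}
    {cons : Set (ProjConstraint Q P)} (hF : F.IsDefinedBy cons) {n : P} {A B : Q.Instance}
    (hA : A ∈ F.inst n) (hB : B ∈ F.inst n) (hne : (answers B).Nonempty) (d : ℕ) :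
    renumber A d ∈ F.inst n := by
  rw [hF] at hA hB ⊢
  intro c hc
  obtain ⟨x, hx⟩ := hne
  have h1 : 1 ≤ (proj B c.atom c.cols).card :=
    Finset.card_pos.2 ⟨_, Finset.mem_image_of_mem _ (hx c.atom)⟩
  have h2 : (1 : ℝ) ≤ c.bound n := le_trans (by exact_mod_cast h1) (hB c hc)
  have h3 : ((proj (renumber A d) c.atom c.cols).card : ℝ) ≤
      max 1 ((proj A c.atom c.cols).card : ℝ) := by
    exact_mod_cast card_proj_renumber_le A d c.atom c.cols
  exact h3.trans (max_le h2 (hA c hc))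

lemma length_le_of_family {P : Type*} [Preorder P] {F : ProblemFamily Q P}
    {cons : Set (ProjConstraint Q P)} (hF : F.IsDefinedBy cons) {n : P} {q : ℕ}
    (hq : IsGreatest ((fun A => (answers A).encard) '' F.inst n) (q : ℕ∞)) (hq0 : 0 < q)
    {A : Q.Instance} (hA : A ∈ F.inst n) {tr : List (Event Q)} (htr : LeapfrogTriejoin A tr) :
    tr.length ≤ nodeCost Q * (q * (2 * Q.numVars + 1)) := by
  obtain ⟨tr', h', -, hl⟩ := exists_leapfrogTriejoin A
  obtain rfl := htr.unique h'
  obtain ⟨B, hB, hBq⟩ := hq.1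
  have hne : (answers B).Nonempty := by
    rw [← Set.encard_pos, show (answers B).encard = q from hBq]
    exact_mod_cast hq0
  have h := sum_work_le hq0 (fun d hd => sum_minChildren_le A hd
    (hq.2 ⟨_, renumber_mem_inst hF hA hB hne d, rfl⟩)) Q.numVars 0 (zero_add _)
  exact hl.trans (by simpa [level] using h)

/-! ### From the number of events to running time, and the lower bound -/

lemma logb_le_logb_of_nat_le {N M : ℕ} (h : N ≤ M) : Real.logb 2 N ≤ Real.logb 2 M := by
  rcases Nat.eq_zero_or_pos N with rfl | hN
  · rw [Nat.cast_zero, Real.logb_zero]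
    rcases Nat.eq_zero_or_pos M with rfl | hM
    · simp
    · exact Real.logb_nonneg one_lt_two (by exact_mod_cast hM)
  · exact Real.logb_le_logb_of_le one_lt_two (by exact_mod_cast hN) (by exact_mod_cast h)

lemma logb_nat_nonneg (N : ℕ) : 0 ≤ Real.logb 2 N := by
  simpa using logb_le_logb_of_nat_le (Nat.zero_le N)

lemma CostModel.Meets.event_le {T : CostModel Q} {K : ℕ} (hT : T.Meets K) (A : Q.Instance)
    (h : List (Event Q)) (e : Event Q) :
    (T A h e : ℝ) ≤ K * (1 + Real.logb 2 (maxCard A)) := by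
  obtain ⟨h₁, h₂, h₃⟩ := hT A h
  have hK : (K : ℝ) ≤ K * (1 + Real.logb 2 (maxCard A)) :=
    le_mul_of_one_le_right (Nat.cast_nonneg K) (by linarith [logb_nat_nonneg (maxCard A)])
  cases e with
  | iter j op =>
    refine ((h₃ j).2.2 op).trans (mul_le_mul_of_nonneg_left ?_ (Nat.cast_nonneg K))
    have : (A j).card ≤ maxCard A := Finset.le_sup (f := fun j => (A j).card) (Finset.mem_univ j)
    linarith [logb_le_logb_of_nat_le this]
  | ram => exact le_trans (by exact_mod_cast h₁) hK
  | emit x => exact le_trans (by exact_mod_cast h₂ x) hK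

lemma CostModel.Meets.time_le {T : CostModel Q} {K : ℕ} (hT : T.Meets K) (A : Q.Instance)
    (tr : List (Event Q)) :
    (T.time A tr : ℝ) ≤ tr.length * (K * (1 + Real.logb 2 (maxCard A))) := by
  rw [CostModel.time, Nat.cast_sum]
  refine (Finset.sum_le_sum fun i _ => hT.event_le A _ _).trans_eq ?_
  simp

/-- On an instance attaining the maximum, `q` distinct tuples must appear among the steps. -/
lemma exists_le_length {S : Set Q.Instance} {q : ℕ}
    (hq : IsGreatest ((fun A => (answers A).encard) '' S) (q : ℕ∞)) {B : Algorithm Q}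
    (hB : B.Computes S) : ∃ A ∈ S, q ≤ (B A).length := by
  classical
  obtain ⟨A, hA, hAq⟩ := hq.1
  refine ⟨A, hA, ?_⟩
  have hsub : answers A ⊆ ((B A).reduceOption.toFinset : Set Q.Assignment) := fun x hx => by
    simpa [List.reduceOption_mem_iff] using (hB A hA x).2 hx
  have h := Set.encard_le_encard hsub
  rw [show (answers A).encard = q from hAq, Set.encard_coe_eq_coe_finsetCard] at h
  have h' : q ≤ (B A).reduceOption.toFinset.card := by exact_mod_cast h
  exact h'.trans ((List.toFinset_card_le _).trans (List.reduceOption_length_le _))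

end JoinQuery

theorem mainTheorem3 (Q : JoinQuery) :
    -- leapfrog triejoin terminates and outputs every tuple of the query result exactly once
    (∀ A : Q.Instance, ∃ tr, JoinQuery.LeapfrogTriejoin A tr ∧ (JoinQuery.output tr).Nodup ∧
      ∀ x, x ∈ JoinQuery.output tr ↔ x ∈ JoinQuery.answers A) ∧
    -- the constant `C` depends only on the query and the constant of the iterators
    (∀ K : ℕ, ∃ C : ℝ, ∀ T : JoinQuery.CostModel Q, T.Meets K →
      ∀ (P : Type*) [Preorder P] (F : JoinQuery.ProblemFamily Q P)
        (cons : Set (JoinQuery.ProjConstraint Q P)), F.IsDefinedBy cons →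
      ∀ (n : P) (q : ℕ),
        IsGreatest ((fun A => (JoinQuery.answers A).encard) '' F.inst n) (q : ℕ∞) → 0 < q →
        ∀ A ∈ F.inst n, ∀ tr, JoinQuery.LeapfrogTriejoin A tr →
          (T.time A tr : ℝ) ≤ C * (q * (1 + Real.logb 2 (JoinQuery.maxCard A))) ∧
          ∀ M : ℕ, IsGreatest (JoinQuery.maxCard '' F.inst n) M →
            (T.time A tr : ℝ) ≤ C * (q * (1 + Real.logb 2 M))) ∧
    -- every algorithm that computes the query needs at least `q(n)` steps in the worst case
    (∀ (P : Type*) [Preorder P] (F : JoinQuery.ProblemFamily Q P)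
        (cons : Set (JoinQuery.ProjConstraint Q P)), F.IsDefinedBy cons →
      ∀ (n : P) (q : ℕ),
        IsGreatest ((fun A => (JoinQuery.answers A).encard) '' F.inst n) (q : ℕ∞) →
        ∀ B : JoinQuery.Algorithm Q, B.Computes (F.inst n) →
          ∃ A ∈ F.inst n, q ≤ (B A).length) := by
  refine ⟨fun A => ?_, fun K => ?_, fun P _ F cons _ n q hq B hB =>
    JoinQuery.exists_le_length hq hB⟩
  · obtain ⟨tr, h, ho, -⟩ := JoinQuery.exists_leapfrogTriejoin A
    refine ⟨tr, h, ho ▸ JoinQuery.nodup_results A _ _ (by simp), fun x => ?_⟩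
    rw [ho, JoinQuery.mem_results_iff_mem_answers]
  -- The number of events per unit of `q`, times the constant in the cost of one event.
  · refine ⟨JoinQuery.nodeCost Q * (2 * Q.numVars + 1) * K,
      fun T hT P _ F cons hF n q hq hq0 A hA tr htr => ?_⟩
    have hlen : (tr.length : ℝ) ≤ JoinQuery.nodeCost Q * (q * (2 * Q.numVars + 1)) := by
      exact_mod_cast JoinQuery.length_le_of_family hF hq hq0 hA htr
    have hbound : ∀ M : ℕ, JoinQuery.maxCard A ≤ M → (T.time A tr : ℝ) ≤
        JoinQuery.nodeCost Q * (2 * Q.numVars + 1) * K * (q * (1 + Real.logb 2 M)) := by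
      intro M hM
      have h0 := JoinQuery.logb_nat_nonneg (JoinQuery.maxCard A)
      have h1 := JoinQuery.logb_le_logb_of_nat_le hM
      calc (T.time A tr : ℝ) ≤ tr.length * (K * (1 + Real.logb 2 (JoinQuery.maxCard A))) :=
            hT.time_le A tr
        _ ≤ JoinQuery.nodeCost Q * (q * (2 * Q.numVars + 1)) * (K * (1 + Real.logb 2 M)) := by
            gcongr
        _ = _ := by ring
    exact ⟨hbound _ le_rfl, fun M hM => hbound M (hM.2 ⟨A, hA, rfl⟩)⟩
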